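/- Let $H$ be a complex Hilbert space and let $A$ be a non-zero bounded positive semidefinite operator on $H$. Write $\langle x,y\rangle_A=\langle Ax,y\rangle$ and $\|x\|_A=\langle x,x\rangle_A^{1/2}$ for $x,y\in H$. Let $B_A(H)$ be the set of bounded operators $T$ on $H$ with $R(T^*A)\subseteq R(A)$, and $B_{A^{1/2}}(H)$ the set of bounded operators $T$ on $H$ with $R(T^*A^{1/2})\subseteq R(A^{1/2})$, where $R(\cdot)$ denotes the range. For $T\in B_A(H)$ let $T^\sharp$ be the unique bounded operator on $H$ with $AT^\sharp=T^*A$ and $R(T^\sharp)\subseteq\overline{R(A)}$; $T$ is called $A$-normal if $T\in B_A(H)$ and $\|Tx\|_A=\|T^\sharp x\|_A$ for all $x\in H$. The $A$-numerical range of $T$ is $$W_A(T)=\{\langle Tx,x\rangle_A : x\in H,\ \|x\|_A=1\}.$$ A non-zero operator $V\in B_{A^{1/2}}(H)$ is called $A$-invertible in $B_{A^{1/2}}(H)$ if there is a non-zero $S\in B_{A^{1/2}}(H)$ with $AVS=ASV=A$. The $A$-spectrum $\sigma_A(T)$ is the set of all $\lambda\in\mathbb C$ such that $\lambda-T$ is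 not $A$-invertible in $B_{A^{1/2}}(H)$. Let $T$ be an $A$-normal operator on $H$ which commutes with $A$. Then $$\overline{W_A(T)}=\mathrm{conv}(\sigma_A(T)),$$ where $\mathrm{conv}$ denotes the convex hull. -/

import Mathlib

noncomputable section

namespace SemiHilbert

variable {H : Type*} [NormedAddCommGroup H] [InnerProductSpace ℂ H] [CompleteSpace H]

/-- The form `⟨x, y⟩_A = ⟨A x, y⟩`, linear in `x` and conjugate-linear in `y`
(Mathlib's `inner` is conjugate-linear in its first argument). -/
def aInner (A : H →L[ℂ] H) (x y : H) : ℂ := inner ℂ y (A x)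

/-- The seminorm `‖x‖_A = ⟨x, x⟩_A ^ (1/2)`. -/
def aNorm (A : H →L[ℂ] H) (x : H) : ℝ := Real.sqrt (aInner A x x).re

/-- `B_A(H)`: the bounded operators `T` with `R(T* A) ⊆ R(A)`. -/
def BA (A : H →L[ℂ] H) : Set (H →L[ℂ] H) :=
  {T | Set.range (T.adjoint ∘L A) ⊆ Set.range A}

/-- `B_{A^{1/2}}(H)`: the bounded operators `T` with `R(T* A^{1/2}) ⊆ R(A^{1/2})`. -/
def BASqrt (A : H →L[ℂ] H) : Set (H →L[ℂ] H) :=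
  {T | Set.range (T.adjoint ∘L (CFC.sqrt A : H →L[ℂ] H)) ⊆ Set.range (CFC.sqrt A : H →L[ℂ] H)}

/-- `S` is the reduced solution of `A X = T* A`: it solves the equation, and its range lies in
the closure of the range of `A`. -/
def IsReducedAdjoint (A T S : H →L[ℂ] H) : Prop :=
  A ∘L S = T.adjoint ∘L A ∧ Set.range S ⊆ closure (Set.range A)

theorem eq_of_mem_closure_range {A : H →L[ℂ] H} (hA : A.IsPositive) {y z : H}
    (hy : y ∈ closure (Set.range A)) (hz : z ∈ closure (Set.range A)) (h : A y = A z) :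
    y = z := by
  have hsa : A.adjoint = A := hA.isSelfAdjoint
  have hmem : y - z ∈ (LinearMap.range (A : H →ₗ[ℂ] H)).topologicalClosure :=
    Submodule.sub_mem _ hy hz
  have hker : y - z ∈ (LinearMap.range (A : H →ₗ[ℂ] H))ᗮ := by
    rintro _ ⟨w, rfl⟩
    have : inner ℂ (A w) (y - z) = inner ℂ w (A (y - z)) := by
      conv_lhs => rw [← hsa]
      exact ContinuousLinearMap.adjoint_inner_left A _ _
    have h0 : A (y - z) = 0 := by rw [map_sub, h, sub_self]
    rw [h0, inner_zero_right] at this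
    exact this
  rw [← Submodule.orthogonal_closure] at hker
  have := Submodule.inner_right_of_mem_orthogonal hmem hker
  exact sub_eq_zero.mp (inner_self_eq_zero.mp this)

theorem exists_mem_closure_range {A : H →L[ℂ] H} (hA : A.IsPositive) (y : H) :
    ∃ z ∈ closure (Set.range A), A z = A y := by
  have hsa : A.adjoint = A := hA.isSelfAdjoint
  let K := (LinearMap.range (A : H →ₗ[ℂ] H)).topologicalClosure
  have : CompleteSpace K :=
    (Submodule.isClosed_topologicalClosure _).completeSpace_coe
  obtain ⟨k, hk, n, hn, hkn⟩ := K.exists_add_mem_mem_orthogonal y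
  refine ⟨k, hk, ?_⟩
  have h0 : A n = 0 := by
    apply ext_inner_left ℂ
    intro w
    have h1 : inner ℂ w (A n) = inner ℂ (A w) n := by
      conv_rhs => rw [← hsa]
      exact (ContinuousLinearMap.adjoint_inner_left A _ _).symm
    rw [h1, inner_zero_right]
    have hw : A w ∈ K := subset_closure ⟨w, rfl⟩
    exact Submodule.inner_right_of_mem_orthogonal hw hn
  rw [hkn, map_add, h0, add_zero]

/-- The reduced solution exists and is unique for `T ∈ B_A(H)`. -/
theorem existsUnique_isReducedAdjoint {A T : H →L[ℂ] H} (hA : A.IsPositive) (hT : T ∈ BA A) :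
    ∃! S, IsReducedAdjoint A T S := by
  have hex : ∀ x, ∃ y ∈ closure (Set.range A), A y = T.adjoint (A x) := by
    intro x
    obtain ⟨y, hy⟩ := hT ⟨x, rfl⟩
    obtain ⟨z, hz, hzy⟩ := exists_mem_closure_range hA y
    exact ⟨z, hz, hzy.trans hy⟩
  choose f hf hAf using hex
  let L : H →ₗ[ℂ] H :=
    { toFun := f
      map_add' := fun x y => eq_of_mem_closure_range hA (hf _)
        ((LinearMap.range (A : H →ₗ[ℂ] H)).topologicalClosure.add_mem (hf x) (hf y))
        (by simp [hAf])
      map_smul' := fun c x => eq_of_mem_closure_range hA (hf _)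
        ((LinearMap.range (A : H →ₗ[ℂ] H)).topologicalClosure.smul_mem c (hf x))
        (by simp [hAf]) }
  have hL : Continuous L := by
    refine L.continuous_of_seq_closed_graph fun u x y hu hLu => ?_
    refine eq_of_mem_closure_range hA ?_ (hf x) ?_
    · exact isClosed_closure.mem_of_tendsto hLu (Filter.Eventually.of_forall fun n => hf (u n))
    · refine tendsto_nhds_unique ((A.continuous.tendsto y).comp hLu) ?_
      change Filter.Tendsto (fun n => A (f (u n))) Filter.atTop (nhds (A (f x)))
      simp only [hAf]
      exact ((T.adjoint ∘L A).continuous.tendsto x).comp hu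
  refine ⟨⟨L, hL⟩, ⟨?_, ?_⟩, ?_⟩
  · ext x
    exact hAf x
  · rintro _ ⟨x, rfl⟩
    exact hf x
  · rintro S ⟨hS, hS'⟩
    ext x
    refine eq_of_mem_closure_range hA (hS' ⟨x, rfl⟩) (hf x) ?_
    exact (congrArg (fun F : H →L[ℂ] H => F x) hS).trans (hAf x).symm

/-- `T^♯`, the reduced solution of `A X = T* A`, for `T ∈ B_A(H)`. -/
def sharp {A T : H →L[ℂ] H} (hA : A.IsPositive) (hT : T ∈ BA A) : H →L[ℂ] H :=
  (existsUnique_isReducedAdjoint hA hT).choose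

theorem isReducedAdjoint_sharp {A T : H →L[ℂ] H} (hA : A.IsPositive) (hT : T ∈ BA A) :
    IsReducedAdjoint A T (sharp hA hT) :=
  (existsUnique_isReducedAdjoint hA hT).choose_spec.1

/-- `T` is `A`-normal: `T ∈ B_A(H)` and `‖T x‖_A = ‖T^♯ x‖_A` for all `x`. -/
def IsANormal {A : H →L[ℂ] H} (hA : A.IsPositive) (T : H →L[ℂ] H) : Prop :=
  ∃ hT : T ∈ BA A, ∀ x, aNorm A (T x) = aNorm A (sharp hA hT x)

/-- The `A`-numerical range `W_A(T) = {⟨T x, x⟩_A : ‖x‖_A = 1}`. -/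
def aNumericalRange (A T : H →L[ℂ] H) : Set ℂ :=
  {z | ∃ x : H, aNorm A x = 1 ∧ aInner A (T x) x = z}

/-- A non-zero `T ∈ B_{A^{1/2}}(H)` is `A`-invertible in `B_{A^{1/2}}(H)` if there is a non-zero
`S ∈ B_{A^{1/2}}(H)` with `A T S = A S T = A`. -/
def IsAInvertible (A T : H →L[ℂ] H) : Prop :=
  T ∈ BASqrt A ∧ T ≠ 0 ∧
    ∃ S ∈ BASqrt A, S ≠ 0 ∧ A ∘L T ∘L S = A ∧ A ∘L S ∘L T = A

/-- The `A`-resolvent set. -/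
def aResolventSet (A T : H →L[ℂ] H) : Set ℂ :=
  {l | IsAInvertible A (l • ContinuousLinearMap.id ℂ H - T)}

/-- The `A`-spectrum. -/
def aSpectrum (A T : H →L[ℂ] H) : Set ℂ := (aResolventSet A T)ᶜ

end SemiHilbert

end

namespace SemiHilbert

open Filter Topology ContinuousLinearMap
open scoped ComplexOrder ComplexConjugate

set_option linter.unusedSectionVars false

/-! Put `R = A^{1/2}` and let `K` be the closure of the range of `R`. Since `T` and `T*` commute
with `R`, `K` reduces `T`; let `N` be the restriction of `T` to `K`. All the `A`-notions become
ordinary ones for `N`: `⟨Tx, x⟩_A = ⟨T(Rx), Rx⟩` and the vectors `Rx` are dense in `K`;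
`A`-normality says `‖T(Rx)‖ = ‖T*(Rx)‖`; `A`-invertibility of `l - T` is invertibility of `l - N`
(`isAInvertible_iff`). It remains to prove the classical equality for normal `N`
(`closure_numericalRange_eq`): approximate eigenvectors give one inclusion, separation by a
half-plane and the functional calculus the other. -/

theorem isCompact_convexHull_of_isCompact {E : Type*} [NormedAddCommGroup E] [NormedSpace ℝ E]
    [FiniteDimensional ℝ E] {s : Set E} (hs : IsCompact s) : IsCompact (convexHull ℝ s) := by
  -- By Carathéodory, at most `finrank + 1` points are needed, so the hull is a finite union of
  -- continuous images of compact sets.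
  have key : convexHull ℝ s = ⋃ k : Fin (Module.finrank ℝ E + 2),
      (fun p : (Fin k → ℝ) × (Fin k → E) => ∑ i, p.1 i • p.2 i) ''
        (stdSimplex ℝ (Fin k) ×ˢ Set.pi Set.univ fun _ => s) := by
    apply Set.Subset.antisymm
    · intro x hx
      obtain ⟨ι, _, z, w, hz, hi, hw, hw1, rfl⟩ := eq_pos_convex_span_of_mem_convexHull hx
      have hcard : Fintype.card ι < Module.finrank ℝ E + 2 :=
        Nat.lt_succ_of_le (hi.card_le_finrank_succ.trans
          (Nat.succ_le_succ (Submodule.finrank_le _)))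
      let e := Fintype.equivFin ι
      refine Set.mem_iUnion.2 ⟨⟨Fintype.card ι, hcard⟩, (w ∘ e.symm, z ∘ e.symm), ⟨⟨?_, ?_⟩, ?_⟩, ?_⟩
      · exact fun i => (hw _).le
      · exact (e.symm.sum_comp w).trans hw1
      · exact fun i _ => hz ⟨_, rfl⟩
      · exact e.symm.sum_comp fun i => w i • z i
    · refine Set.iUnion_subset fun k => ?_
      rintro _ ⟨⟨w, z⟩, ⟨⟨hw, hw1⟩, hz⟩, rfl⟩
      exact (convex_convexHull ℝ s).sum_mem (fun i _ => hw i) hw1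
        fun i _ => subset_convexHull ℝ s (hz i trivial)
  rw [key]
  refine isCompact_iUnion fun k => ?_
  exact ((isCompact_stdSimplex ℝ (Fin k)).prod (isCompact_univ_pi fun _ => hs)).image (by fun_prop)

/-! ### Numerical range and spectrum of a normal operator -/

variable {E : Type*} [NormedAddCommGroup E] [InnerProductSpace ℂ E] [CompleteSpace E]

/-- The numerical range of an operator. -/
def numericalRange (N : E →L[ℂ] E) : Set ℂ := {z | ∃ x : E, ‖x‖ = 1 ∧ inner ℂ x (N x) = z}

/-- For normal `M` the orthogonal complement of the range is the kernel, so the lower bound yields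
dense range as well as injectivity and closed range. -/
theorem isUnit_of_isStarNormal_of_bound {M : E →L[ℂ] E} (hM : IsStarNormal M) {c : ℝ} (hc : 0 < c)
    (h : ∀ x, c * ‖x‖ ≤ ‖M x‖) : IsUnit M := by
  rw [isUnit_iff_bijective, bijective_iff_dense_range_and_antilipschitz]
  constructor
  · rw [Submodule.topologicalClosure_eq_top_iff, hM.orthogonal_range, LinearMap.ker_eq_bot']
    intro x hx
    have h1 := h x
    have h2 : M x = 0 := hx
    rw [h2, norm_zero] at h1
    have : ‖x‖ ≤ 0 := by
      by_contra! h3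
      exact absurd h1 (not_le.2 (mul_pos hc h3))
    simpa using this
  · refine ⟨(c⁻¹).toNNReal, M.antilipschitz_of_bound fun x => ?_⟩
    rw [Real.coe_toNNReal _ (inv_pos.2 hc).le, inv_mul_eq_div, le_div_iff₀ hc, mul_comm]
    exact h x

theorem isStarNormal_sub_smul {N : E →L[ℂ] E} (hN : IsStarNormal N) (l : ℂ) :
    IsStarNormal (l • (1 : E →L[ℂ] E) - N) := by
  refine ⟨?_⟩
  have h := hN.star_comm_self
  rw [star_sub, star_smul, star_one]
  exact ((Commute.one_left _).smul_left _).sub_left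
    (((Commute.one_right _).smul_right _).sub_right h)

/-- Every point of the spectrum of a normal operator is an approximate eigenvalue. -/
theorem exists_norm_eq_one_norm_sub_lt {N : E →L[ℂ] E} (hN : IsStarNormal N) {l : ℂ}
    (hl : l ∈ spectrum ℂ N) {ε : ℝ} (hε : 0 < ε) :
    ∃ x : E, ‖x‖ = 1 ∧ ‖l • x - N x‖ < ε := by
  by_contra! hcon
  refine hl ?_
  change IsUnit _
  rw [Algebra.algebraMap_eq_smul_one]
  refine isUnit_of_isStarNormal_of_bound (isStarNormal_sub_smul hN l) hε fun x => ?_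
  rcases eq_or_ne x 0 with rfl | hx
  · simp
  have hx' : (‖x‖ : ℝ) ≠ 0 := norm_ne_zero_iff.2 hx
  have h1 := hcon (((‖x‖⁻¹ : ℝ) : ℂ) • x) (by
    rw [norm_smul, Complex.norm_real, norm_inv, norm_norm, inv_mul_cancel₀ hx'])
  rw [map_smul, smul_comm, ← smul_sub, norm_smul, Complex.norm_real, norm_inv, norm_norm,
    inv_mul_eq_div, le_div_iff₀ (norm_pos_iff.2 hx)] at h1
  simpa using h1

theorem norm_adjoint_sub {N : E →L[ℂ] E} (hN : IsStarNormal N) (l : ℂ) (x : E) :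
    ‖conj l • x - N.adjoint x‖ = ‖l • x - N x‖ := by
  have := isStarNormal_iff_norm_eq_adjoint.1 (isStarNormal_sub_smul hN l) x
  have h2 : (l • (1 : E →L[ℂ] E) - N).adjoint = conj l • (1 : E →L[ℂ] E) - N.adjoint := by
    rw [← star_eq_adjoint, star_sub, star_smul, star_one]; rfl
  rw [h2] at this
  simpa using this.symm

/-- Approximate eigenvectors of a normal operator for distinct eigenvalues are asymptotically
orthogonal. -/
theorem tendsto_inner_zero {N : E →L[ℂ] E} (hN : IsStarNormal N) {l m : ℂ} (hlm : l ≠ m)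
    {x y : ℕ → E} (hx1 : ∀ n, ‖x n‖ = 1) (hy1 : ∀ n, ‖y n‖ = 1)
    (hx : Tendsto (fun n => ‖l • x n - N (x n)‖) atTop (𝓝 0))
    (hy : Tendsto (fun n => ‖m • y n - N (y n)‖) atTop (𝓝 0)) :
    Tendsto (fun n => inner ℂ (x n) (y n)) atTop (𝓝 0) := by
  have hb : ∀ n, ‖inner ℂ (x n) (y n)‖ ≤
      ‖m - l‖⁻¹ * (‖m • y n - N (y n)‖ + ‖l • x n - N (x n)‖) := by
    intro n
    -- Moving `N` across the inner product cancels its two occurrences; both remaining terms are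
    -- small because `x n` is also an approximate eigenvector of `N*`.
    have e : (m - l) * inner ℂ (x n) (y n) =
        inner ℂ (x n) (m • y n - N (y n)) - inner ℂ (conj l • x n - N.adjoint (x n)) (y n) := by
      rw [inner_sub_right, inner_sub_left, inner_smul_right, inner_smul_left, adjoint_inner_left,
        Complex.conj_conj]
      ring
    rw [← div_eq_inv_mul, le_div_iff₀ (norm_pos_iff.2 (sub_ne_zero.2 hlm.symm)), mul_comm,
      ← norm_mul, e]
    refine (norm_sub_le _ _).trans (add_le_add ?_ ?_)
    · exact (norm_inner_le_norm _ _).trans (by rw [hx1, one_mul])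
    · exact (norm_inner_le_norm _ _).trans (by rw [hy1, mul_one, norm_adjoint_sub hN])
  refine squeeze_zero_norm hb ?_
  simpa using (hy.add hx).const_mul ‖m - l‖⁻¹

theorem convexHull_spectrum_subset {N : E →L[ℂ] E} (hN : IsStarNormal N) :
    convexHull ℝ (spectrum ℂ N) ⊆ closure (numericalRange N) := by
  intro z hz
  rw [convexHull_eq_union_convexHull_finite_subsets] at hz
  simp only [Set.mem_iUnion] at hz
  obtain ⟨s, hs, hz⟩ := hz
  obtain ⟨w, hw, hw1, rfl⟩ := Finset.mem_convexHull'.1 hz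
  have hex : ∀ l : s, ∀ n : ℕ, ∃ x : E, ‖x‖ = 1 ∧ ‖(l : ℂ) • x - N x‖ < 1 / ((n : ℝ) + 1) :=
    fun l n => exists_norm_eq_one_norm_sub_lt hN (hs l.2) (by positivity)
  choose X hX1 hX using hex
  have hX0 : ∀ l : s, Tendsto (fun n => ‖(l : ℂ) • X l n - N (X l n)‖) atTop (𝓝 0) := fun l =>
    squeeze_zero (fun _ => norm_nonneg _) (fun n => (hX l n).le)
      tendsto_one_div_add_atTop_nhds_zero_nat
  have hin : ∀ l m : s, Tendsto (fun n => inner ℂ (X l n) (X m n)) atTop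
      (𝓝 (if l = m then 1 else 0)) := by
    intro l m
    split_ifs with h
    · subst h
      refine tendsto_const_nhds.congr fun n => ?_
      rw [inner_self_eq_norm_sq_to_K, hX1]; simp
    · exact tendsto_inner_zero hN (fun h' => h (Subtype.ext h')) (hX1 l) (hX1 m) (hX0 l) (hX0 m)
  have hinN : ∀ l m : s, Tendsto (fun n => inner ℂ (X l n) (N (X m n))) atTop
      (𝓝 (if l = m then (m : ℂ) else 0)) := by
    intro l m
    have h1 : Tendsto (fun n => inner ℂ (X l n) ((m : ℂ) • X m n - N (X m n))) atTop (𝓝 0) :=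
      squeeze_zero_norm (fun n => (norm_inner_le_norm _ _).trans (by rw [hX1, one_mul])) (hX0 m)
    have h2 := ((hin l m).const_mul (m : ℂ)).sub h1
    convert h2 using 2 with n
    · rw [inner_sub_right, inner_smul_right]; ring
    · simp
  -- With square roots of the convex weights as coefficients, asymptotic orthonormality makes the
  -- Rayleigh quotient of the combination tend to `∑ w l • l`.
  let c : s → ℂ := fun l => ((Real.sqrt (w l) : ℝ) : ℂ)
  have hc : ∀ l, conj (c l) * c l = (w l : ℂ) := fun l => by
    rw [Complex.conj_ofReal, ← Complex.ofReal_mul, Real.mul_self_sqrt (hw l l.2)]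
  let Y : ℕ → E := fun n => ∑ l, c l • X l n
  have hYY : Tendsto (fun n => inner ℂ (Y n) (Y n)) atTop (𝓝 1) := by
    have : Tendsto (fun n => ∑ l, ∑ m, conj (c l) * (c m * inner ℂ (X l n) (X m n))) atTop
        (𝓝 (∑ l : s, ∑ m : s, conj (c l) * (c m * if l = m then 1 else 0))) :=
      tendsto_finsetSum _ fun l _ => tendsto_finsetSum _ fun m _ =>
        ((hin l m).const_mul _).const_mul _
    convert this using 2
    · simp only [Y, sum_inner, inner_sum, inner_smul_left, inner_smul_right,
        Finset.mul_sum]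
      exact Finset.sum_comm.trans
        (Finset.sum_congr rfl fun _ _ => Finset.sum_congr rfl fun _ _ => by ring)
    · simp only [mul_ite, mul_one, mul_zero, Finset.sum_ite_eq, Finset.mem_univ, if_true, hc]
      rw [Finset.sum_coe_sort s fun l => (w l : ℂ), ← Complex.ofReal_sum, hw1, Complex.ofReal_one]
  have hYN : Tendsto (fun n => inner ℂ (Y n) (N (Y n))) atTop (𝓝 (∑ l ∈ s, w l • l)) := by
    have : Tendsto (fun n => ∑ l, ∑ m, conj (c l) * (c m * inner ℂ (X l n) (N (X m n)))) atTop
        (𝓝 (∑ l : s, ∑ m : s, conj (c l) * (c m * if l = m then (m : ℂ) else 0))) :=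
      tendsto_finsetSum _ fun l _ => tendsto_finsetSum _ fun m _ =>
        ((hinN l m).const_mul _).const_mul _
    convert this using 2
    · simp only [Y, map_sum, map_smul, sum_inner, inner_sum, inner_smul_left, inner_smul_right,
        Finset.mul_sum]
      exact Finset.sum_comm.trans
        (Finset.sum_congr rfl fun _ _ => Finset.sum_congr rfl fun _ _ => by ring)
    · simp only [mul_ite, mul_zero, Finset.sum_ite_eq, Finset.mem_univ, if_true, ← mul_assoc, hc]
      rw [Finset.sum_coe_sort s fun l => (w l : ℂ) * l]
      simp only [Complex.real_smul]
  have hlim := hYN.div hYY one_ne_zero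
  rw [div_one] at hlim
  refine mem_closure_of_tendsto hlim ?_
  filter_upwards [hYY.eventually_ne one_ne_zero] with n hn
  have hn' : Y n ≠ 0 := fun h => hn (by rw [h, inner_zero_left])
  have hn'' : ‖Y n‖ ≠ 0 := norm_ne_zero_iff.2 hn'
  refine ⟨((‖Y n‖⁻¹ : ℝ) : ℂ) • Y n, ?_, ?_⟩
  · rw [norm_smul, Complex.norm_real, norm_inv, norm_norm, inv_mul_cancel₀ hn'']
  · rw [map_smul, inner_smul_left, inner_smul_right, Complex.conj_ofReal, Pi.div_apply,
      inner_self_eq_norm_sq_to_K]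
    have : ((‖Y n‖ : ℝ) : ℂ) ≠ 0 := by exact_mod_cast hn''
    simp only [Complex.coe_algebraMap, Complex.ofReal_inv]
    field_simp

/-- A point outside the hull is cut off by a real functional `f` with `f < u` on the spectrum. The
functional calculus turns this into `f(N) ≤ u`, hence `f ⟨Nx, x⟩ ≤ u` for unit `x`. -/
theorem numericalRange_subset_convexHull {N : E →L[ℂ] E} (hN : IsStarNormal N) :
    numericalRange N ⊆ convexHull ℝ (spectrum ℂ N) := by
  rintro _ ⟨x, hx, rfl⟩
  by_contra hcon
  obtain ⟨f, u, hfu, hux⟩ := geometric_hahn_banach_closed_point (convex_convexHull ℝ _)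
    (isCompact_convexHull_of_isCompact (spectrum.isCompact N)).isClosed hcon
  -- Chosen so that `f z = 2 Re (a z)`.
  let a : ℂ := ⟨f 1 / 2, -(f Complex.I / 2)⟩
  have hf : ∀ z : ℂ, ((f z : ℝ) : ℂ) = a * z + conj a * conj z := by
    intro z
    have h1 : f z = z.re * f 1 + z.im * f Complex.I := by
      conv_lhs => rw [← Complex.re_add_im z]
      have : ((z.re : ℂ) + z.im * Complex.I) = z.re • (1 : ℂ) + z.im • Complex.I := by simp
      rw [this, map_add, map_smul, map_smul, smul_eq_mul, smul_eq_mul]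
    rw [h1]
    apply Complex.ext <;> simp [a] <;> ring
  have hle : cfc (fun z : ℂ => a * z + conj a * conj z) N ≤ algebraMap ℂ (E →L[ℂ] E) (u : ℂ) := by
    refine cfc_le_algebraMap _ _ _ fun z hz => ?_
    rw [← hf]
    exact_mod_cast (hfu z (subset_convexHull ℝ _ hz)).le
  have hcfc : cfc (fun z : ℂ => a * z + conj a * conj z) N = a • N + conj a • star N := by
    rw [cfc_add (a := N) (fun z : ℂ => a * z) (fun z => conj a * conj z),
      cfc_const_mul_id a N, cfc_const_mul (conj a) (fun z => conj z) N]
    congr 2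
    exact cfc_star_id N
  rw [hcfc, ContinuousLinearMap.le_def] at hle
  have h2 := hle.re_inner_nonneg_right x
  rw [sub_apply, inner_sub_right, add_apply, inner_add_right, smul_apply, smul_apply,
    inner_smul_right, inner_smul_right, star_eq_adjoint, adjoint_inner_right,
    ← inner_conj_symm (N x) x, ← hf, Algebra.algebraMap_eq_smul_one, smul_apply,
    one_apply_eq_self, inner_smul_right, inner_self_eq_norm_sq_to_K, hx] at h2
  simp at h2
  linarith

theorem closure_numericalRange_eq {N : E →L[ℂ] E} (hN : IsStarNormal N) :
    closure (numericalRange N) = convexHull ℝ (spectrum ℂ N) :=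
  (closure_minimal (numericalRange_subset_convexHull hN)
    (isCompact_convexHull_of_isCompact (spectrum.isCompact N)).isClosed).antisymm
    (convexHull_spectrum_subset hN)

/-! ### Compression to the closure of the range of a self-adjoint operator -/

variable {H : Type*} [NormedAddCommGroup H] [InnerProductSpace ℂ H] [CompleteSpace H]

/-- The closure of the range of an operator. -/
def rangeClosure (R : H →L[ℂ] H) : Submodule ℂ H :=
  (LinearMap.range (R : H →ₗ[ℂ] H)).topologicalClosure

instance (R : H →L[ℂ] H) : CompleteSpace (rangeClosure R) :=
  (Submodule.isClosed_topologicalClosure _).completeSpace_coe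

theorem apply_mem_rangeClosure (R : H →L[ℂ] H) (x : H) : R x ∈ rangeClosure R :=
  Submodule.le_topologicalClosure _ ⟨x, rfl⟩

theorem mem_rangeClosure_orthogonal_iff {R : H →L[ℂ] H} (hR : IsSelfAdjoint R) {x : H} :
    x ∈ (rangeClosure R)ᗮ ↔ R x = 0 := by
  rw [rangeClosure, Submodule.orthogonal_closure]
  have h := R.orthogonal_range
  rw [hR.adjoint_eq] at h
  exact (SetLike.ext_iff.1 h x)

theorem mem_rangeClosure_of_commute {R T : H →L[ℂ] H} (hTR : Commute T R) {x : H}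
    (hx : x ∈ rangeClosure R) : T x ∈ rangeClosure R := by
  have : Set.MapsTo T (Set.range R) (Set.range R) := by
    rintro _ ⟨y, rfl⟩
    exact ⟨T y, (DFunLike.congr_fun hTR.eq y).symm⟩
  exact this.closure T.continuous hx

/-- The compression of an operator to a closed subspace. -/
noncomputable def compression (K : Submodule ℂ H) [CompleteSpace K] (T : H →L[ℂ] H) : K →L[ℂ] K :=
  K.orthogonalProjectionOnto ∘L T ∘L K.subtypeL

/-- The extension by zero of an operator on a closed subspace. -/
noncomputable def extendByZero (K : Submodule ℂ H) [CompleteSpace K] (S : K →L[ℂ] K) : H →L[ℂ] H :=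
  K.subtypeL ∘L S ∘L K.orthogonalProjectionOnto

theorem adjoint_compression (K : Submodule ℂ H) [CompleteSpace K] (T : H →L[ℂ] H) :
    (compression K T).adjoint = compression K T.adjoint := by
  rw [compression, adjoint_comp, adjoint_comp, K.adjoint_subtypeL,
    K.adjoint_orthogonalProjectionOnto]
  rfl

theorem coe_compression_apply {K : Submodule ℂ H} [CompleteSpace K] {T : H →L[ℂ] H} {x : K}
    (hx : T x ∈ K) : (compression K T x : H) = T x :=
  Submodule.starProjection_eq_self_iff.2 hx

section Commuting

variable {R T : H →L[ℂ] H}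

theorem apply_orthogonalProjectionOnto (hR : IsSelfAdjoint R) (x : H) :
    R ((rangeClosure R).orthogonalProjectionOnto x) = R x := by
  have := (mem_rangeClosure_orthogonal_iff hR).1
    ((rangeClosure R).sub_starProjection_mem_orthogonal x)
  rw [map_sub, sub_eq_zero] at this
  exact this.symm

theorem coe_compression (hTR : Commute T R) (x : rangeClosure R) :
    (compression (rangeClosure R) T x : H) = T x :=
  coe_compression_apply (mem_rangeClosure_of_commute hTR x.2)

/-- `T` preserves `ker R`, which is the orthogonal complement of `rangeClosure R`. -/
theorem compression_orthogonalProjectionOnto (hR : IsSelfAdjoint R) (hTR : Commute T R) (x : H) :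
    compression (rangeClosure R) T ((rangeClosure R).orthogonalProjectionOnto x) =
      (rangeClosure R).orthogonalProjectionOnto (T x) := by
  have h : R (x - (rangeClosure R).orthogonalProjectionOnto x) = 0 := by
    rw [map_sub, apply_orthogonalProjectionOnto hR, sub_self]
  have h2 : R (T (x - (rangeClosure R).orthogonalProjectionOnto x)) = 0 := by
    have := DFunLike.congr_fun hTR.eq (x - (rangeClosure R).orthogonalProjectionOnto x)
    change T (R _) = R (T _) at this
    rw [← this, h, map_zero]
  have h3 := (rangeClosure R).orthogonalProjectionOnto_eq_zero_iff.2
    ((mem_rangeClosure_orthogonal_iff hR).2 h2)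
  rw [map_sub, map_sub, sub_eq_zero] at h3
  exact h3.symm

theorem orthogonalProjectionOnto_eq_of_apply_eq (hR : IsSelfAdjoint R) {x y : H}
    (h : R x = R y) : (rangeClosure R).orthogonalProjectionOnto x =
      (rangeClosure R).orthogonalProjectionOnto y := by
  rw [← sub_eq_zero, ← map_sub, Submodule.orthogonalProjectionOnto_eq_zero_iff,
    mem_rangeClosure_orthogonal_iff hR, map_sub, h, sub_self]

theorem isStarNormal_compression (hR : IsSelfAdjoint R) (hTR : Commute T R)
    (h : ∀ x, ‖R (T x)‖ = ‖R (T.adjoint x)‖) :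
    IsStarNormal (compression (rangeClosure R) T) := by
  have hTR' : Commute T.adjoint R := by
    have := hTR.star_star
    rwa [hR.star_eq] at this
  have hK : ∀ x ∈ rangeClosure R, ‖T x‖ = ‖T.adjoint x‖ := by
    intro x hx
    have hc : IsClosed {x : H | ‖T x‖ = ‖T.adjoint x‖} := isClosed_eq (by fun_prop) (by fun_prop)
    refine closure_minimal ?_ hc hx
    rintro _ ⟨y, rfl⟩
    have h1 : T (R y) = R (T y) := DFunLike.congr_fun hTR.eq y
    have h2 : T.adjoint (R y) = R (T.adjoint y) := DFunLike.congr_fun hTR'.eq y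
    change ‖T (R y)‖ = ‖T.adjoint (R y)‖
    rw [h1, h2, h]
  rw [isStarNormal_iff_norm_eq_adjoint]
  intro x
  rw [adjoint_compression, ← Submodule.norm_coe, ← Submodule.norm_coe, coe_compression hTR,
    coe_compression hTR', hK x x.2]

theorem compression_eq_one_of_comp (hR : IsSelfAdjoint R) {U : H →L[ℂ] H}
    (h : ∀ x, R (U x) = R x) : compression (rangeClosure R) U = 1 := by
  ext x
  change (((rangeClosure R).orthogonalProjectionOnto (U x) : rangeClosure R) : H) = x
  rw [orthogonalProjectionOnto_eq_of_apply_eq hR (h x),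
    Submodule.orthogonalProjectionOnto_mem_subspace_eq_self]

/-- `TS` and `ST` are the identity modulo `ker R`, so they compress to `1`. Compression is
multiplicative here because `T` preserves both `rangeClosure R` and its complement; `S` need not. -/
theorem isUnit_compression (hR : IsSelfAdjoint R) (hTR : Commute T R) {S : H →L[ℂ] H}
    (h1 : ∀ x, R (T (S x)) = R x) (h2 : ∀ x, R (S (T x)) = R x) :
    IsUnit (compression (rangeClosure R) T) := by
  refine ⟨⟨_, compression (rangeClosure R) S, ?_, ?_⟩, rfl⟩
  · rw [← compression_eq_one_of_comp hR (U := T ∘L S) h1]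
    ext1 x
    exact compression_orthogonalProjectionOnto hR hTR _
  · rw [← compression_eq_one_of_comp hR (U := S ∘L T) h2]
    ext1 x
    change (rangeClosure R).orthogonalProjectionOnto
      (S (compression (rangeClosure R) T x : rangeClosure R)) = _
    rw [coe_compression hTR]
    rfl

theorem extendByZero_of_commute (hR : IsSelfAdjoint R)
    {S : rangeClosure R →L[ℂ] rangeClosure R}
    (hS : Commute S (compression (rangeClosure R) R)) :
    Commute (extendByZero (rangeClosure R) S) R := by
  ext x
  change ((S ((rangeClosure R).orthogonalProjectionOnto (R x)) : rangeClosure R) : H) =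
    R (S ((rangeClosure R).orthogonalProjectionOnto x) : rangeClosure R)
  rw [← compression_orthogonalProjectionOnto hR (Commute.refl R), ← coe_compression (Commute.refl R)]
  exact congrArg Subtype.val (DFunLike.congr_fun hS.eq _)

theorem compression_commute (hTR : Commute T R) :
    Commute (compression (rangeClosure R) T) (compression (rangeClosure R) R) := by
  ext x
  change (compression (rangeClosure R) T (compression (rangeClosure R) R x) : H) =
    (compression (rangeClosure R) R (compression (rangeClosure R) T x) : H)
  rw [coe_compression hTR, coe_compression (Commute.refl R), coe_compression (Commute.refl R),
    coe_compression hTR]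
  exact DFunLike.congr_fun hTR.eq _

end Commuting

/-! ### Translation of the `A`-notions through `A^{1/2}` -/

variable {A : H →L[ℂ] H}

theorem isSelfAdjoint_sqrt (A : H →L[ℂ] H) : IsSelfAdjoint (CFC.sqrt A) :=
  (CFC.sqrt_nonneg A).isSelfAdjoint

theorem sqrt_apply_sqrt_apply (hA : A.IsPositive) (x : H) : CFC.sqrt A (CFC.sqrt A x) = A x :=
  DFunLike.congr_fun (CFC.sqrt_mul_sqrt_self A ((nonneg_iff_isPositive A).2 hA)) x

theorem aInner_eq_inner_sqrt (hA : A.IsPositive) (x y : H) :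
    aInner A x y = inner ℂ (CFC.sqrt A y) (CFC.sqrt A x) := by
  rw [aInner, ← sqrt_apply_sqrt_apply hA, ← adjoint_inner_left, (isSelfAdjoint_sqrt A).adjoint_eq]

theorem aNorm_eq_norm_sqrt (hA : A.IsPositive) (x : H) : aNorm A x = ‖CFC.sqrt A x‖ := by
  rw [aNorm, aInner_eq_inner_sqrt hA, inner_self_eq_norm_sq_to_K]
  have : (((‖CFC.sqrt A x‖ : ℝ) : ℂ) ^ 2).re = ‖CFC.sqrt A x‖ ^ 2 := by
    rw [← Complex.ofReal_pow, Complex.ofReal_re]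
  exact (congrArg Real.sqrt this).trans (Real.sqrt_sq (norm_nonneg _))

/-- `A` and its square root have the same kernel, as `⟨Ax, x⟩ = ‖A^{1/2} x‖²`. -/
theorem sqrt_apply_eq_iff (hA : A.IsPositive) {x y : H} :
    CFC.sqrt A x = CFC.sqrt A y ↔ A x = A y := by
  refine ⟨fun h => by rw [← sqrt_apply_sqrt_apply hA, h, sqrt_apply_sqrt_apply hA], fun h => ?_⟩
  have h0 : A (x - y) = 0 := by rw [map_sub, h, sub_self]
  have := aInner_eq_inner_sqrt hA (x - y) (x - y)
  rw [aInner, h0, inner_zero_right, eq_comm, inner_self_eq_zero, map_sub, sub_eq_zero] at this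
  exact this

theorem commute_sqrt {T : H →L[ℂ] H} (h : Commute T A) : Commute T (CFC.sqrt A) :=
  (h.symm.cfcₙ_nnreal NNReal.sqrt).symm

theorem mem_BASqrt_of_commute {T : H →L[ℂ] H} (h : Commute T (CFC.sqrt A)) : T ∈ BASqrt A := by
  have h' := h.star_star
  rw [(isSelfAdjoint_sqrt A).star_eq] at h'
  rintro _ ⟨x, rfl⟩
  exact ⟨T.adjoint x, (DFunLike.congr_fun h'.eq x).symm⟩

/-- An operator commuting with `A` is `A`-invertible if and only if its restriction to the closure
of the range of `A^{1/2}` is invertible. -/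
theorem isAInvertible_iff (hA : A.IsPositive) (hA0 : A ≠ 0) {V : H →L[ℂ] H} (hV : Commute V A) :
    IsAInvertible A V ↔ IsUnit (compression (rangeClosure (CFC.sqrt A)) V) := by
  have hR := isSelfAdjoint_sqrt A
  have hVR := commute_sqrt hV
  constructor
  · rintro ⟨-, -, S, -, -, h1, h2⟩
    exact isUnit_compression hR hVR
      (fun x => (sqrt_apply_eq_iff hA).2 (DFunLike.congr_fun h1 x))
      (fun x => (sqrt_apply_eq_iff hA).2 (DFunLike.congr_fun h2 x))
  · rintro ⟨u, hu⟩
    -- The inverse inherits commutation with `A^{1/2}`, which puts its extension in `BASqrt A`.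
    let S := extendByZero (rangeClosure (CFC.sqrt A)) u⁻¹.val
    have hS : Commute S (CFC.sqrt A) := extendByZero_of_commute hR
      (Commute.units_inv_left (by rw [hu]; exact compression_commute hVR))
    have h1 : A ∘L V ∘L S = A := by
      ext x
      refine (sqrt_apply_eq_iff hA).1 ?_
      change CFC.sqrt A (V
        ((u⁻¹.val ((rangeClosure (CFC.sqrt A)).orthogonalProjectionOnto x) :
          rangeClosure (CFC.sqrt A)) : H)) = _
      rw [← coe_compression hVR, ← hu]
      have := DFunLike.congr_fun u.mul_inv ((rangeClosure (CFC.sqrt A)).orthogonalProjectionOnto x)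
      change u.val (u⁻¹.val ((rangeClosure (CFC.sqrt A)).orthogonalProjectionOnto x)) =
        (rangeClosure (CFC.sqrt A)).orthogonalProjectionOnto x at this
      rw [this]
      exact apply_orthogonalProjectionOnto hR x
    have h2 : A ∘L S ∘L V = A := by
      ext x
      refine (sqrt_apply_eq_iff hA).1 ?_
      change CFC.sqrt A
        ((u⁻¹.val ((rangeClosure (CFC.sqrt A)).orthogonalProjectionOnto (V x)) :
          rangeClosure (CFC.sqrt A)) : H) = _
      rw [← compression_orthogonalProjectionOnto hR hVR, ← hu]
      have := DFunLike.congr_fun u.inv_mul ((rangeClosure (CFC.sqrt A)).orthogonalProjectionOnto x)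
      change u⁻¹.val (u.val ((rangeClosure (CFC.sqrt A)).orthogonalProjectionOnto x)) =
        (rangeClosure (CFC.sqrt A)).orthogonalProjectionOnto x at this
      rw [this]
      exact apply_orthogonalProjectionOnto hR x
    refine ⟨mem_BASqrt_of_commute hVR, ?_, S, mem_BASqrt_of_commute hS, ?_, h1, h2⟩
    · intro h
      rw [h, zero_comp, comp_zero] at h1
      exact hA0 h1.symm
    · intro h
      rw [h, zero_comp, comp_zero] at h2
      exact hA0 h2.symm

theorem aSpectrum_eq_spectrum_compression (hA : A.IsPositive) (hA0 : A ≠ 0) {T : H →L[ℂ] H}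
    (hTA : Commute T A) :
    aSpectrum A T = spectrum ℂ (compression (rangeClosure (CFC.sqrt A)) T) := by
  ext l
  have hV : Commute (l • ContinuousLinearMap.id ℂ H - T) A :=
    ((Commute.one_left A).smul_left l).sub_left hTA
  change ¬ IsAInvertible A _ ↔ ¬ IsUnit _
  rw [isAInvertible_iff hA hA0 hV]
  have : compression (rangeClosure (CFC.sqrt A)) (l • ContinuousLinearMap.id ℂ H - T) =
      algebraMap ℂ _ l - compression (rangeClosure (CFC.sqrt A)) T := by
    ext1 x
    simp [compression, Algebra.algebraMap_eq_smul_one]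
  rw [this]

theorem isStarNormal_compression_of_isANormal {hA : A.IsPositive} {T : H →L[ℂ] H}
    (hT : IsANormal hA T) (hTA : Commute T A) :
    IsStarNormal (compression (rangeClosure (CFC.sqrt A)) T) := by
  refine isStarNormal_compression (isSelfAdjoint_sqrt A) (commute_sqrt hTA) fun x => ?_
  obtain ⟨hB, hn⟩ := hT
  rw [← aNorm_eq_norm_sqrt hA, hn, aNorm_eq_norm_sqrt hA]
  -- `A T^♯ = T* A = A T*`, and `A` may be replaced by its square root.
  congr 1
  refine (sqrt_apply_eq_iff hA).2 ?_
  have h' := hTA.star_star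
  rw [hA.isSelfAdjoint.star_eq] at h'
  exact (DFunLike.congr_fun (isReducedAdjoint_sharp hA hB).1 x).trans (DFunLike.congr_fun h'.eq x)

theorem closure_aNumericalRange (hA : A.IsPositive) {T : H →L[ℂ] H} (hTA : Commute T A) :
    closure (aNumericalRange A T) =
      closure (numericalRange (compression (rangeClosure (CFC.sqrt A)) T)) := by
  have hTR := commute_sqrt hTA
  have hcomm : ∀ x, T (CFC.sqrt A x) = CFC.sqrt A (T x) := fun x => DFunLike.congr_fun hTR.eq x
  have hin : ∀ x : rangeClosure (CFC.sqrt A),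
      inner ℂ x (compression (rangeClosure (CFC.sqrt A)) T x) = inner ℂ (x : H) (T x) := fun x => by
    rw [Submodule.coe_inner, coe_compression hTR]
  apply Set.Subset.antisymm
  · refine closure_mono ?_
    rintro _ ⟨x, hx, rfl⟩
    refine ⟨⟨CFC.sqrt A x, apply_mem_rangeClosure _ x⟩, ?_, ?_⟩
    · exact (aNorm_eq_norm_sqrt hA x).symm.trans hx
    · rw [hin, aInner_eq_inner_sqrt hA, hcomm]
  · refine closure_minimal ?_ isClosed_closure
    rintro _ ⟨x, hx, rfl⟩
    rw [hin]
    obtain ⟨y, hy, hyx⟩ := mem_closure_iff_seq_limit.1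
      (show (x : H) ∈ closure (Set.range _) from x.2)
    choose z hz' using hy
    have hz : ∀ n, CFC.sqrt A (z n) = y n := hz'
    -- A unit vector of the closure is only a limit of vectors `y n` in the range, not of norm one,
    -- hence the quotients.
    have hlim : Tendsto (fun n => inner ℂ (y n) (T (y n)) / ((‖y n‖ ^ 2 : ℝ) : ℂ)) atTop
        (𝓝 (inner ℂ (x : H) (T x))) := by
      have h1 := hyx.inner (𝕜 := ℂ) ((T.continuous.tendsto _).comp hyx)
      have h2 : Tendsto (fun n => ((‖y n‖ ^ 2 : ℝ) : ℂ)) atTop (𝓝 ((‖(x : H)‖ ^ 2 : ℝ) : ℂ)) :=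
        (Complex.continuous_ofReal.tendsto _).comp (hyx.norm.pow 2)
      have hx' : ‖(x : H)‖ = 1 := hx
      rw [hx'] at h2
      have h3 := h1.div h2 (by rw [one_pow, Complex.ofReal_one]; exact one_ne_zero)
      rw [one_pow, Complex.ofReal_one, div_one] at h3
      exact h3
    refine mem_closure_of_tendsto hlim ?_
    have hne : (‖(x : H)‖ : ℝ) ≠ 0 := by
      rw [show ‖(x : H)‖ = 1 from hx]; exact one_ne_zero
    filter_upwards [hyx.norm.eventually_ne hne] with n hn
    refine ⟨((‖y n‖⁻¹ : ℝ) : ℂ) • z n, ?_, ?_⟩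
    · rw [aNorm_eq_norm_sqrt hA, map_smul, hz, norm_smul, Complex.norm_real, norm_inv, norm_norm,
        inv_mul_cancel₀ hn]
    · rw [aInner_eq_inner_sqrt hA, ← hcomm, map_smul, map_smul, inner_smul_left, inner_smul_right,
        hz, Complex.conj_ofReal, Complex.ofReal_inv, Complex.ofReal_pow, pow_two, ← mul_assoc,
        ← mul_inv, inv_mul_eq_div]

end SemiHilbert

theorem mainTheorem1 {H : Type*} [NormedAddCommGroup H] [InnerProductSpace ℂ H] [CompleteSpace H]
    (A : H →L[ℂ] H) (hA : A.IsPositive) (hA0 : A ≠ 0)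
    (T : H →L[ℂ] H) (hT : SemiHilbert.IsANormal hA T) (hTA : Commute T A) :
    closure (SemiHilbert.aNumericalRange A T) = convexHull ℝ (SemiHilbert.aSpectrum A T) := by
  rw [SemiHilbert.closure_aNumericalRange hA hTA,
    SemiHilbert.aSpectrum_eq_spectrum_compression hA hA0 hTA]
  exact SemiHilbert.closure_numericalRange_eq
    (SemiHilbert.isStarNormal_compression_of_isANormal hT hTA)
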